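/- Let $n\ge 0$ and let $\mathbb{Q}\langle X_n\rangle=\mathbb{Q}\langle x_1,\dots,x_n\rangle$ be the algebra of polynomials in $n$ noncommuting variables, graded by degree, with homogeneous components $V_r$ $(r\ge 0)$ spanned by the monomials of length $r$. The symmetric group $\mathfrak{S}_n$ acts on it by algebra automorphisms permuting the variables, $\sigma\cdot x_i=x_{\sigma(i)}$. Let $\mathit{Sym}$ be the ring of symmetric functions over $\mathbb{Q}$ in an infinite alphabet $X$, with power sums $p_k$ and complete homogeneous functions $h_k$ ($h_0=1$), and write $p_\lambda=\prod_i p_{\lambda_i}$, $h_\lambda=\prod_i h_{\lambda_i}$. For a finite-dimensional representation $V$ of $\mathfrak{S}_n$ over $\mathbb{Q}$ with character $\chi^V$, its Frobenius characteristic is $$\mathcal{F}rob_{\mathfrak{S}_n}(V)=\frac1{n!}\sum_{\sigma\in\mathfrak{S}_n}\chi^V(\sigma)\,p_{\mathrm{cyc}(\sigma)}[X],$$ where $\mathrm{cyc}(\sigma)$ is the cycle type of $\sigma$ (fixed points included), and the graded Frobenius characteristic of $\mathbb{Q}\langle X_n\rangle$ is the formal power series $\mathcal{F}rob_{\mathfrak{S}_n}(\mathbb{Q}\langle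 X_n\rangle)=\sum_{r\ge0}q^r\,\mathcal{F}rob_{\mathfrak{S}_n}(V_r)\in\mathit{Sym}[[q]]$. Then $$\mathcal{F}rob_{\mathfrak{S}_n}(\mathbb{Q}\langle X_n\rangle)=\sum_{d=0}^n\frac{q^d}{\{q;q\}_d}\,h_{(n-d,1^d)}[X],$$ where $\{q;q\}_d=(1-q)(1-2q)\cdots(1-dq)$ and $h_{(n-d,1^d)}=h_{n-d}h_1^d$. -/

import Mathlib

noncomputable section

/-- The ring `Sym` of symmetric functions over `ℚ` in the countably infinite alphabet
`x_0, x_1, x_2, …`: the formal power series of bounded degree that are invariant under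
all permutations of the variables. -/
def SymFun : Subalgebra ℚ (MvPowerSeries ℕ ℚ) where
  carrier := {f |
    (∀ (e : Equiv.Perm ℕ) (m : ℕ →₀ ℕ),
      MvPowerSeries.coeff (m.mapDomain e) f = MvPowerSeries.coeff m f) ∧
    ∃ N : ℕ, ∀ m : ℕ →₀ ℕ, MvPowerSeries.coeff m f ≠ 0 → m.degree ≤ N}
  mul_mem' := by
    classical
    rintro f g ⟨hf, Nf, hNf⟩ ⟨hg, Ng, hNg⟩
    refine ⟨fun e m => ?_, Nf + Ng, fun m hm => ?_⟩
    · rw [MvPowerSeries.coeff_mul, MvPowerSeries.coeff_mul]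
      symm
      have key : ∀ (e : Equiv.Perm ℕ) (a : ℕ →₀ ℕ),
          (a.mapDomain e).mapDomain e.symm = a := fun e a => by
        rw [← Finsupp.mapDomain_comp, Equiv.symm_comp_self, Finsupp.mapDomain_id]
      refine Finset.sum_nbij' (fun p => (p.1.mapDomain e, p.2.mapDomain e))
        (fun p => (p.1.mapDomain e.symm, p.2.mapDomain e.symm)) ?_ ?_ ?_ ?_ ?_
      · intro p hp
        rw [Finset.HasAntidiagonal.mem_antidiagonal] at hp ⊢
        rw [← hp, Finsupp.mapDomain_add]
      · intro p hp
        rw [Finset.HasAntidiagonal.mem_antidiagonal] at hp ⊢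
        rw [← key e m, ← hp, Finsupp.mapDomain_add]
      · intro p _
        simp only [key]
      · intro p _
        have := key e.symm
        rw [Equiv.symm_symm] at this
        simp only [this]
      · intro p _
        simp only [hf, hg]
    · rw [MvPowerSeries.coeff_mul] at hm
      obtain ⟨p, hp, hne⟩ := Finset.exists_ne_zero_of_sum_ne_zero hm
      rw [Finset.HasAntidiagonal.mem_antidiagonal] at hp
      rw [← hp, map_add]
      exact Nat.add_le_add (hNf _ (left_ne_zero_of_mul hne)) (hNg _ (right_ne_zero_of_mul hne))
  add_mem' := by
    rintro f g ⟨hf, Nf, hNf⟩ ⟨hg, Ng, hNg⟩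
    refine ⟨fun e m => by rw [map_add, map_add, hf, hg], max Nf Ng, fun m hm => ?_⟩
    rw [map_add] at hm
    by_cases h : MvPowerSeries.coeff m f = 0
    · rw [h, zero_add] at hm
      exact (hNg m hm).trans (le_max_right _ _)
    · exact (hNf m h).trans (le_max_left _ _)
  algebraMap_mem' := by
    classical
    intro r
    rw [MvPowerSeries.algebraMap_apply]
    refine ⟨fun e m => ?_, 0, fun m hm => ?_⟩
    · rw [MvPowerSeries.coeff_C, MvPowerSeries.coeff_C]
      have : m.mapDomain e = 0 ↔ m = 0 := by
        rw [← Finsupp.degree_eq_zero_iff, Finsupp.degree_mapDomain, Finsupp.degree_eq_zero_iff]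
      simp only [this]
    · rw [MvPowerSeries.coeff_C] at hm
      have : m = 0 := by
        by_contra h
        exact hm (if_neg h)
      simp [this]

namespace SymFun

open Classical in
/-- The power sum `p_k = ∑_i x_i ^ k` (for `k ≥ 1`): the sum of the monomials `x_i ^ k`. -/
def p (k : ℕ) : SymFun :=
  ⟨fun m => if ∃ i, m = Finsupp.single i k then 1 else 0, by
    refine ⟨fun e m => ?_, k, fun m hm => ?_⟩
    · have : (∃ i, m.mapDomain e = Finsupp.single i k) ↔ ∃ i, m = Finsupp.single i k := by
        constructor
        · rintro ⟨i, hi⟩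
          refine ⟨e.symm i, Finsupp.mapDomain_injective e.injective ?_⟩
          rw [hi, Finsupp.mapDomain_single, Equiv.apply_symm_apply]
        · rintro ⟨i, rfl⟩
          exact ⟨e i, Finsupp.mapDomain_single⟩
      change (if _ then (1 : ℚ) else 0) = if _ then 1 else 0
      simp only [this]
    · change (if _ then (1 : ℚ) else 0) ≠ 0 at hm
      obtain ⟨i, rfl⟩ : ∃ i, m = Finsupp.single i k := by
        by_contra h
        exact hm (if_neg h)
      rw [Finsupp.degree_single]⟩

/-- The complete homogeneous symmetric function `h_k`: the sum of all monomials of degree `k`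
(so `h_0 = 1`). -/
def h (k : ℕ) : SymFun :=
  ⟨fun m => if m.degree = k then 1 else 0, by
    refine ⟨fun e m => ?_, k, fun m hm => ?_⟩
    · change (if _ then (1 : ℚ) else 0) = if _ then 1 else 0
      rw [Finsupp.degree_mapDomain]
    · change (if _ then (1 : ℚ) else 0) ≠ 0 at hm
      by_contra hk
      exact hm (if_neg fun h => hk h.le)⟩

/-- `p_λ = p_{λ₁} p_{λ₂} ⋯`, for the multiset of parts of `λ`. -/
def pProd (l : Multiset ℕ) : SymFun := (l.map p).prod

/-- `h_λ = h_{λ₁} h_{λ₂} ⋯`, for the multiset of parts of `λ`; parts `0` contribute `h_0 = 1`. -/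
def hProd (l : Multiset ℕ) : SymFun := (l.map h).prod

end SymFun

/-- The Frobenius characteristic of a (finite-dimensional) representation of `S_n` over `ℚ`,
`(1 / n!) ∑_{σ ∈ S_n} χ(σ) p_{cyc(σ)}`, where `cyc(σ)` is the partition of `n` formed by the
lengths of all cycles of `σ`, fixed points included. -/
def frob {n : ℕ} {V : Type*} [AddCommGroup V] [Module ℚ V]
    (ρ : Representation ℚ (Equiv.Perm (Fin n)) V) : SymFun :=
  (n.factorial : ℚ)⁻¹ •
    ∑ σ : Equiv.Perm (Fin n), ρ.character σ • SymFun.pProd σ.partition.parts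

/-- The graded Frobenius characteristic `∑_r q ^ r Frob(V_r)`, an element of `Sym⟦q⟧`, of a
representation of `S_n` graded by the subrepresentations `V_r`. -/
def gradedFrob {n : ℕ} {V : Type*} [AddCommGroup V] [Module ℚ V]
    {ρ : Representation ℚ (Equiv.Perm (Fin n)) V} (A : ℕ → Subrepresentation ρ)
    (_hA : DirectSum.IsInternal fun r => (A r).toSubmodule)
    (_hfin : ∀ r, Module.Finite ℚ (A r).toSubmodule) : PowerSeries SymFun :=
  PowerSeries.mk fun r => frob (A r).toRepresentation

/-- The action of `S_n` on `ℚ⟨X_n⟩` on variables: `σ` acts as the algebra endomorphism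
with `x_i ↦ x_{σ(i)}`. -/
def variableAction (n : ℕ) :
    Representation ℚ (Equiv.Perm (Fin n)) (FreeAlgebra ℚ (Fin n)) where
  toFun σ := (FreeAlgebra.lift ℚ fun i => FreeAlgebra.ι ℚ (σ i)).toLinearMap
  map_one' := by
    have : (FreeAlgebra.lift ℚ fun i : Fin n => FreeAlgebra.ι ℚ i) = AlgHom.id ℚ _ := by
      ext i; simp
    simp only [Equiv.Perm.one_apply, this]
    rfl
  map_mul' σ τ := by
    rw [Module.End.mul_eq_comp, ← AlgHom.comp_toLinearMap]
    congr 1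
    ext i
    simp

/-- The monomial `x_{w_1} x_{w_2} ⋯ x_{w_r}` of `ℚ⟨X_n⟩`. -/
def ncMonomial {n : ℕ} (w : List (Fin n)) : FreeAlgebra ℚ (Fin n) :=
  (w.map (FreeAlgebra.ι ℚ)).prod

theorem variableAction_ncMonomial {n : ℕ} (σ : Equiv.Perm (Fin n)) (w : List (Fin n)) :
    variableAction n σ (ncMonomial w) = ncMonomial (w.map σ) := by
  change FreeAlgebra.lift ℚ (fun i => FreeAlgebra.ι ℚ (σ i)) (ncMonomial w) = _
  simp only [ncMonomial, map_list_prod, List.map_map]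
  congr 2
  ext i
  simp

/-- The homogeneous component of degree `r` of `ℚ⟨X_n⟩`, spanned by the monomials of degree `r`,
as a subrepresentation. -/
def ncHomogeneous (n r : ℕ) : Subrepresentation (variableAction n) where
  toSubmodule := Submodule.span ℚ (ncMonomial '' {w : List (Fin n) | w.length = r})
  apply_mem_toSubmodule σ v hv := by
    induction hv using Submodule.span_induction with
    | mem x hx =>
      obtain ⟨w, hw, rfl⟩ := hx
      rw [variableAction_ncMonomial]
      exact Submodule.subset_span ⟨_, by simpa using hw, rfl⟩
    | zero => rw [map_zero]; exact Submodule.zero_mem _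
    | add x y _ _ hx hy => rw [map_add]; exact Submodule.add_mem _ hx hy
    | smul c x _ hx => rw [map_smul]; exact Submodule.smul_mem _ c hx

theorem ncHomogeneous_finite (n r : ℕ) :
    Module.Finite ℚ (ncHomogeneous n r).toSubmodule :=
  Module.Finite.span_of_finite ℚ ((List.finite_length_eq (Fin n) r).image _)

theorem ncMonomial_eq_basis {n : ℕ} (w : FreeMonoid (Fin n)) :
    ncMonomial w.toList = FreeAlgebra.basisFreeMonoid ℚ (Fin n) w := by
  have h1 : FreeAlgebra.basisFreeMonoid ℚ (Fin n) w =
      FreeAlgebra.equivMonoidAlgebraFreeMonoid.symm (MonoidAlgebra.single w 1) := by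
    simp [FreeAlgebra.basisFreeMonoid]
  have h2 : ∀ a, (FreeAlgebra.equivMonoidAlgebraFreeMonoid (R := ℚ) (X := Fin n)).symm a =
      MonoidAlgebra.lift ℚ (FreeAlgebra ℚ (Fin n)) (FreeMonoid (Fin n))
        (FreeMonoid.lift (FreeAlgebra.ι ℚ)) a := fun _ => rfl
  rw [h1, h2, MonoidAlgebra.lift_single, one_smul, FreeMonoid.lift_apply, ncMonomial]

theorem ncHomogeneous_isInternal (n : ℕ) :
    DirectSum.IsInternal fun r => (ncHomogeneous n r).toSubmodule := by
  have hb : (ncMonomial : List (Fin n) → _) =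
      FreeAlgebra.basisFreeMonoid ℚ (Fin n) ∘ FreeMonoid.ofList :=
    funext fun w => ncMonomial_eq_basis (FreeMonoid.ofList w)
  have hli : LinearIndependent ℚ (ncMonomial : List (Fin n) → _) := by
    rw [hb]
    exact (FreeAlgebra.basisFreeMonoid ℚ (Fin n)).linearIndependent.comp _
      FreeMonoid.ofList.injective
  refine DirectSum.isInternal_submodule_of_iSupIndep_of_iSup_eq_top (fun r => ?_) ?_
  · simp only [ncHomogeneous, ← Submodule.span_iUnion, ← Set.image_iUnion]
    refine hli.disjoint_span_image ?_
    rw [Set.disjoint_left]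
    rintro w hw hw'
    simp only [Set.mem_iUnion, Set.mem_ofPred_eq] at hw hw'
    obtain ⟨j, hj, rfl⟩ := hw'
    exact hj hw
  · simp only [ncHomogeneous, ← Submodule.span_iUnion, ← Set.image_iUnion]
    have : (⋃ r, {w : List (Fin n) | w.length = r}) = Set.univ := by ext; simp
    rw [this, Set.image_univ, hb, Set.range_comp, FreeMonoid.ofList.range_eq_univ,
      Set.image_univ]
    exact (FreeAlgebra.basisFreeMonoid ℚ (Fin n)).span_eq

/-- `{q;q}_d = (1 - q)(1 - 2q) ⋯ (1 - dq)`. -/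
def curlyPochhammer (d : ℕ) : PowerSeries ℚ :=
  ∏ i ∈ Finset.Icc 1 d, (1 - PowerSeries.C (i : ℚ) * PowerSeries.X)

end

/-! The monomials form a basis of `V_r` on which `S_n` acts by permutations, so the character of
`V_r` at `σ` is `fix(σ) ^ r = ∑ d, S(r, d) * fix(σ) (fix(σ) - 1) ⋯ (fix(σ) - d + 1)`, where
`S(r, d)` are the Stirling numbers of the second kind and `fix(σ)` is the number of fixed points.

For a set `D` of `d` points, the sum of `p_{cyc(σ)}` over the `σ` fixing `D` pointwise is
`(n - d)! h_{n - d} h_1 ^ d`. This comes from `∑_{σ ∈ S_k} p_{cyc(σ)} = k! h_k`: the coefficient of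
a monomial in `p_{cyc(σ)}` counts the `σ`-invariant colorings with the corresponding content, and
as the colorings of a given content form a single orbit of `S_k`, Burnside's lemma applies. Summing
over `D` gives `Frob(V_r) = ∑ d, S(r, d) h_{n - d} h_1 ^ d`, and
`∑ r, S(r, d) q ^ r = q ^ d / {q;q}_d`. -/

section CycleClasses

open Equiv.Perm
open scoped Finset

variable {α : Type*}

/-- The cycles of a permutation, fixed points included, encoded as the classes of the relation
`Equiv.Perm.SameCycle`. -/
abbrev CycleClass (σ : Equiv.Perm α) : Type _ := Quotient (SameCycle.setoid σ)

namespace CycleClass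

/-- The cycle through a given point. -/
abbrev mk (σ : Equiv.Perm α) (i : α) : CycleClass σ := Quotient.mk _ i

variable {σ : Equiv.Perm α}

theorem mk_eq_mk {i j : α} : mk σ i = mk σ j ↔ σ.SameCycle i j :=
  Quotient.eq

theorem mk_apply (i : α) : mk σ (σ i) = mk σ i :=
  mk_eq_mk.2 (sameCycle_apply_left.2 .rfl)

theorem apply_eq_of_comp_eq {β : Type*} {f : α → β} (hf : f ∘ σ = f) {i j : α}
    (h : σ.SameCycle i j) : f i = f j := by
  obtain ⟨k, rfl⟩ := h
  have hk := (MulAction.stabilizer (Equiv.Perm α)ᵈᵐᵃ f).zpow_mem (x := DomMulAct.mk σ) hf k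
  exact (congrFun hk i).symm

/-- Functions on the cycles of `σ` as the `σ`-invariant functions on points. -/
def liftEquiv {β : Type*} : (CycleClass σ → β) ≃ {f : α → β // f ∘ σ = f} where
  toFun g := ⟨g ∘ mk σ, funext fun i => congrArg g (mk_apply i)⟩
  invFun f := Quotient.lift f.1 fun _ _ h => apply_eq_of_comp_eq f.2 h
  left_inv _ := funext <| Quotient.ind fun _ => rfl
  right_inv _ := rfl

variable [Fintype α] [DecidableEq α]

instance : DecidableEq (CycleClass σ) :=
  @Quotient.decidableEq _ _ fun i j => inferInstanceAs (Decidable (σ.SameCycle i j))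

instance : Fintype (CycleClass σ) :=
  @Quotient.fintype _ _ _ fun i j => inferInstanceAs (Decidable (σ.SameCycle i j))

/-- The length of a cycle, equal to `1` for a fixed point. -/
def length (c : CycleClass σ) : ℕ := #{i | mk σ i = c}

theorem length_ne_zero (c : CycleClass σ) : c.length ≠ 0 := by
  obtain ⟨i, rfl⟩ := Quotient.exists_rep c
  exact Finset.card_ne_zero_of_mem (Finset.mem_filter.2 ⟨Finset.mem_univ i, rfl⟩)

theorem length_mk_of_mem_support {i : α} (hi : i ∈ σ.support) :
    (mk σ i).length = #(σ.cycleOf i).support := by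
  refine congrArg Finset.card (Finset.ext fun j => ?_)
  rw [Finset.mem_filter_univ, mk_eq_mk, sameCycle_comm, mem_support_cycleOf_iff]
  exact (and_iff_left hi).symm

theorem length_mk_of_apply_eq_self {i : α} (hi : σ i = i) : (mk σ i).length = 1 := by
  refine Finset.card_eq_one.2 ⟨i, Finset.ext fun j => ?_⟩
  rw [Finset.mem_filter_univ, Finset.mem_singleton, mk_eq_mk]
  exact ⟨fun h => (h.symm.eq_of_left hi).symm, fun h => h ▸ .rfl⟩

variable {M : Type*} [CommMonoid M]

theorem prod_image_support (f : ℕ → M) :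
    ∏ c ∈ σ.support.image (mk σ), f c.length = ∏ τ ∈ σ.cycleFactorsFinset, f #τ.support := by
  refine Finset.prod_nbij (Quotient.lift σ.cycleOf fun _ _ h => SameCycle.cycleOf_eq h)
    ?_ ?_ ?_ ?_
  · simp only [Finset.forall_mem_image]
    exact fun i hi => cycleOf_mem_cycleFactorsFinset_iff.2 hi
  · simp only [Finset.coe_image, Set.InjOn, Set.forall_mem_image]
    exact fun i hi j hj h =>
      mk_eq_mk.2 ((sameCycle_iff_cycleOf_eq_of_mem_support hi hj).2 h)
  · intro τ hτ
    obtain ⟨i, hi⟩ := (mem_cycleFactorsFinset_iff.1 hτ).1.nonempty_support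
    have hiσ : i ∈ σ.support := mem_cycleFactorsFinset_support_le hτ hi
    exact ⟨mk σ i, Finset.mem_coe.2 (Finset.mem_image_of_mem _ hiσ), (cycle_is_cycleOf hi hτ).symm⟩
  · simp only [Finset.forall_mem_image]
    exact fun i hi => congrArg f (length_mk_of_mem_support hi)

theorem prod_image_compl_support (f : ℕ → M) :
    ∏ c ∈ σ.supportᶜ.image (mk σ), f c.length = f 1 ^ #σ.supportᶜ := by
  have hfix : ∀ i ∈ σ.supportᶜ, σ i = i := fun i hi =>
    notMem_support.1 (Finset.mem_compl.1 hi)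
  rw [Finset.prod_image fun i hi j _ h => (mk_eq_mk.1 h).eq_of_left (hfix i hi),
    Finset.prod_congr rfl fun i hi => congrArg f (length_mk_of_apply_eq_self (hfix i hi)),
    Finset.prod_const]

theorem disjoint_image_support :
    Disjoint (σ.support.image (mk σ)) (σ.supportᶜ.image (mk σ)) := by
  refine Finset.disjoint_left.2 fun c hc hc' => ?_
  obtain ⟨i, hi, rfl⟩ := Finset.mem_image.1 hc
  obtain ⟨j, hj, hji⟩ := Finset.mem_image.1 hc'
  have hj' : σ j = j := notMem_support.1 (Finset.mem_compl.1 hj)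
  exact mem_support.1 hi ((mk_eq_mk.1 hji).apply_eq_self_iff.1 hj')

theorem prod_length_eq_prod_map_parts_partition (f : ℕ → M) :
    ∏ c : CycleClass σ, f c.length = (σ.partition.parts.map f).prod := by
  have huniv : (Finset.univ : Finset (CycleClass σ)) =
      σ.support.image (mk σ) ∪ σ.supportᶜ.image (mk σ) := by
    rw [← Finset.image_union, Finset.union_compl,
      Finset.image_univ_of_surjective Quotient.mk_surjective]
  rw [huniv, Finset.prod_union disjoint_image_support, prod_image_support,
    prod_image_compl_support, parts_partition, Multiset.map_add, Multiset.prod_add,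
    Multiset.map_replicate, Multiset.prod_replicate, Finset.card_compl, cycleType_def,
    Multiset.map_map]
  rfl

end CycleClass

end CycleClasses

section Coloring

variable {α β : Type*} [Fintype α]

/-- The content of a coloring `f`: the exponent vector of the monomial `∏ i, x_{f i}`. -/
noncomputable def coloringContent (f : α → β) : β →₀ ℕ := ∑ i, Finsupp.single (f i) 1

theorem degree_coloringContent (f : α → β) : (coloringContent f).degree = Fintype.card α := by
  simp [coloringContent, map_sum]

theorem coloringContent_apply (f : α → β) (b : β) :
    coloringContent f b = Nat.card {i // f i = b} := by
  classical
  rw [coloringContent, Finsupp.finsetSum_apply, Nat.card_eq_fintype_card, Fintype.card_subtype,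
    Finset.card_filter]
  simp only [Finsupp.single_apply]

theorem exists_coloringContent_eq {m : β →₀ ℕ} (hm : m.degree = Fintype.card α) :
    ∃ f : α → β, coloringContent f = m := by
  classical
  have hcard : Fintype.card α = Fintype.card m.toMultiset := by
    rw [Multiset.card_coe, Finsupp.card_toMultiset, ← hm]
    exact Finsupp.degree_apply m
  let e := Fintype.equivOfCardEq hcard
  refine ⟨fun i => (e i).1, Finsupp.orderIsoMultiset.injective ?_⟩
  simp only [Finsupp.coe_orderIsoMultiset]
  rw [coloringContent, e.sum_comp fun x => Finsupp.single x.1 1, map_sum]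
  simp only [Finsupp.toMultiset_single, one_smul]
  rw [Finset.sum_eq_multiset_sum, Multiset.map_univ _ fun b => ({b} : Multiset β),
    Multiset.sum_map_singleton]

theorem coloringContent_eq_iff {f g : α → β} :
    coloringContent f = coloringContent g ↔ ∃ σ : Equiv.Perm α, f ∘ σ = g := by
  constructor
  · intro h
    have hfiber (b : β) : Nonempty ({i // g i = b} ≃ {i // f i = b}) := by
      rw [← Finite.card_eq, ← coloringContent_apply, ← coloringContent_apply, h]
    exact ⟨Equiv.ofFiberEquiv fun b => (hfiber b).some,
      funext fun i => Equiv.ofFiberEquiv_map _ i⟩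
  · rintro ⟨σ, rfl⟩
    exact (Equiv.sum_comp σ fun i => Finsupp.single (f i) 1).symm

theorem sum_card_fixedBy_of_isPretransitive (G X : Type*) [Group G] [Fintype G] [MulAction G X]
    [MulAction.IsPretransitive G X] [Nonempty X] :
    ∑ g : G, Nat.card (MulAction.fixedBy X g) = Fintype.card G := by
  classical
  have : Finite X := Finite.of_surjective (fun g : G => g • Classical.arbitrary X)
    (MulAction.surjective_smul G _)
  have := Fintype.ofFinite X
  obtain ⟨_⟩ := (MulAction.pretransitive_iff_unique_quotient_of_nonempty G X).1 ‹_›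
  simp only [Nat.card_eq_fintype_card]
  rw [MulAction.sum_card_fixedBy_eq_card_orbits_mul_card_group, Fintype.card_unique, one_mul]

variable [DecidableEq α]

theorem sum_card_fixed_coloring {m : β →₀ ℕ} (hm : m.degree = Fintype.card α) :
    ∑ σ : Equiv.Perm α, Nat.card {f : α → β // coloringContent f = m ∧ f ∘ σ = f} =
      (Fintype.card α).factorial := by
  obtain ⟨f₀, rfl⟩ := exists_coloringContent_eq hm
  let X := MulAction.orbit (Equiv.Perm α)ᵈᵐᵃ f₀
  have : Nonempty X := ⟨f₀, MulAction.mem_orbit_self f₀⟩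
  have hX (f : α → β) : f ∈ X ↔ coloringContent f = coloringContent f₀ := by
    rw [eq_comm, coloringContent_eq_iff]
    exact DomMulAct.mk.symm.exists_congr_left
  let := Fintype.ofEquiv (Equiv.Perm α) DomMulAct.mk
  rw [← Fintype.card_perm, Fintype.card_congr DomMulAct.mk,
    ← sum_card_fixedBy_of_isPretransitive (Equiv.Perm α)ᵈᵐᵃ X, ← Equiv.sum_comp DomMulAct.mk]
  refine Finset.sum_congr rfl fun σ _ => Nat.card_congr ?_
  have e₁ := Equiv.subtypeEquivRight fun f : α → β =>
    and_congr_left' (c := f ∘ σ = f) (hX f).symm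
  have e₂ := (Equiv.subtypeSubtypeEquivSubtypeInter (· ∈ X) fun f => f ∘ σ = f).symm
  refine (e₁.trans e₂).trans (Equiv.subtypeEquivRight ?_)
  exact fun f => (Subtype.ext_iff (a1 := DomMulAct.mk σ • f) (a2 := f)).symm

end Coloring

namespace SymFun

theorem coeff_p (k : ℕ) (m : ℕ →₀ ℕ) [Decidable (∃ i, m = Finsupp.single i k)] :
    MvPowerSeries.coeff m (p k : MvPowerSeries ℕ ℚ) =
      if ∃ i, m = Finsupp.single i k then 1 else 0 := by
  rw [MvPowerSeries.coeff_apply]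
  unfold p
  congr!

theorem coeff_h (k : ℕ) (m : ℕ →₀ ℕ) :
    MvPowerSeries.coeff m (h k : MvPowerSeries ℕ ℚ) = if m.degree = k then 1 else 0 :=
  rfl

theorem p_one : p 1 = h 1 := by
  classical
  refine Subtype.ext (MvPowerSeries.ext fun m => ?_)
  have hm : (∃ i, m = Finsupp.single i 1) ↔ m.degree = 1 := by
    simpa only [Set.mem_range, Set.mem_ofPred_eq, eq_comm] using
      Set.ext_iff.1 Finsupp.range_single_one m
  simp only [coeff_h, coeff_p, hm]

theorem coeff_prod_p {ι : Type*} [Fintype ι] {k : ι → ℕ} (hk : ∀ c, k c ≠ 0) (m : ℕ →₀ ℕ) :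
    MvPowerSeries.coeff m ((∏ c, p (k c) : SymFun) : MvPowerSeries ℕ ℚ) =
      Nat.card {g : ι → ℕ // ∑ c, Finsupp.single (g c) (k c) = m} := by
  classical
  rw [SubmonoidClass.coe_finsetProd, MvPowerSeries.coeff_prod]
  simp only [coeff_p, Fintype.prod_boole]
  rw [Finset.sum_boole, ← Nat.card_eq_finsetCard, Nat.cast_inj]
  let monomials (g : ι → ℕ) : ι →₀ ℕ →₀ ℕ :=
    Finsupp.equivFunOnFinite.symm fun c => Finsupp.single (g c) (k c)
  have monomials_injective : Function.Injective monomials := fun g g' hg =>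
    funext fun c => Finsupp.single_left_injective (hk c) (DFunLike.congr_fun hg c)
  symm
  refine Nat.card_congr (Equiv.ofBijective (fun g => ⟨monomials g.1, ?_⟩) ⟨fun g g' hg => ?_, ?_⟩)
  · rw [Finset.mem_filter, Finset.mem_finsuppAntidiag]
    exact ⟨⟨g.2, Finset.subset_univ _⟩, fun c => ⟨g.1 c, rfl⟩⟩
  · exact Subtype.ext (monomials_injective (congrArg Subtype.val hg))
  · rintro ⟨l, hl⟩
    rw [Finset.mem_filter, Finset.mem_finsuppAntidiag] at hl
    choose g hg using hl.2
    obtain rfl : l = monomials g := Finsupp.ext hg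
    exact ⟨⟨g, hl.1.1⟩, rfl⟩

end SymFun

section CycleIndex

open scoped Finset

variable {α : Type*} [Fintype α] [DecidableEq α]

theorem coloringContent_comp_cycleClassMk {β : Type*} {σ : Equiv.Perm α} (g : CycleClass σ → β) :
    coloringContent (g ∘ CycleClass.mk σ) = ∑ c, Finsupp.single (g c) c.length := by
  rw [coloringContent, ← Finset.sum_fiberwise _ (CycleClass.mk σ)]
  refine Finset.sum_congr rfl fun c _ => ?_
  have hfiber : ∀ i ∈ ({i | CycleClass.mk σ i = c} : Finset α),
      Finsupp.single ((g ∘ CycleClass.mk σ) i) 1 = Finsupp.single (g c) 1 := fun i hi => by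
    rw [Function.comp_apply, (Finset.mem_filter.1 hi).2]
  rw [Finset.sum_congr rfl hfiber, Finset.sum_const, ← CycleClass.length, Finsupp.smul_single,
    smul_eq_mul, mul_one]

theorem coeff_pProd_partition (σ : Equiv.Perm α) (m : ℕ →₀ ℕ) :
    MvPowerSeries.coeff m (SymFun.pProd σ.partition.parts : MvPowerSeries ℕ ℚ) =
      Nat.card {f : α → ℕ // coloringContent f = m ∧ f ∘ σ = f} := by
  rw [SymFun.pProd, ← CycleClass.prod_length_eq_prod_map_parts_partition,
    SymFun.coeff_prod_p CycleClass.length_ne_zero, Nat.cast_inj]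
  simp only [← coloringContent_comp_cycleClassMk]
  have e₁ := CycleClass.liftEquiv.subtypeEquiv (q := fun f : {f : α → ℕ // f ∘ σ = f} =>
    coloringContent f.1 = m) fun g : CycleClass σ → ℕ => Iff.rfl
  have e₂ := Equiv.subtypeSubtypeEquivSubtypeInter (fun f : α → ℕ => f ∘ σ = f)
    fun f => coloringContent f = m
  exact Nat.card_congr ((e₁.trans e₂).trans (Equiv.subtypeEquivRight fun _ => and_comm))

theorem sum_pProd_partition :
    ∑ σ : Equiv.Perm α, SymFun.pProd σ.partition.parts =
      (Fintype.card α).factorial • SymFun.h (Fintype.card α) := by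
  refine Subtype.ext (MvPowerSeries.ext fun m => ?_)
  rw [AddSubmonoidClass.coe_finsetSum, map_sum, AddSubmonoidClass.coe_nsmul, map_nsmul,
    SymFun.coeff_h]
  simp only [coeff_pProd_partition]
  split_ifs with hm
  · rw [nsmul_one, ← sum_card_fixed_coloring hm, Nat.cast_sum]
  · rw [nsmul_zero]
    refine Finset.sum_eq_zero fun σ _ => ?_
    rw [Nat.cast_eq_zero, Nat.card_eq_zero]
    exact Or.inl ⟨fun f => hm (f.2.1 ▸ degree_coloringContent f.1)⟩

theorem parts_partition_ofSubtype (D : Finset α) (τ : Equiv.Perm {i // i ∉ D}) :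
    (Equiv.Perm.ofSubtype τ).partition.parts =
      τ.partition.parts + Multiset.replicate #D 1 := by
  have hcard : Fintype.card {i // i ∉ D} = Fintype.card α - #D := by simp
  have hD := D.card_le_univ
  have hτ := τ.support.card_le_univ
  rw [Equiv.Perm.parts_partition, Equiv.Perm.parts_partition, Equiv.Perm.cycleType_ofSubtype,
    Equiv.Perm.support_ofSubtype, Finset.card_map, add_assoc, ← Multiset.replicate_add]
  congr 2
  omega

theorem sum_pProd_partition_of_subset_compl_support (D : Finset α) :
    ∑ σ : Equiv.Perm α with D ⊆ σ.supportᶜ, SymFun.pProd σ.partition.parts =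
      (Fintype.card α - #D).factorial •
        (SymFun.h (Fintype.card α - #D) * SymFun.h 1 ^ #D) := by
  have hfix (σ : Equiv.Perm α) : D ⊆ σ.supportᶜ ↔ ∀ i, ¬ i ∉ D → σ i = i := by
    simp only [Finset.subset_iff, Finset.mem_compl, Equiv.Perm.notMem_support, not_not]
  have hcard : Fintype.card {i // i ∉ D} = Fintype.card α - #D := by simp
  have hpProd (τ : Equiv.Perm {i // i ∉ D}) :
      SymFun.pProd (Equiv.Perm.ofSubtype τ).partition.parts =
        SymFun.pProd τ.partition.parts * SymFun.h 1 ^ #D := by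
    rw [parts_partition_ofSubtype, SymFun.pProd, Multiset.map_add, Multiset.prod_add,
      Multiset.map_replicate, Multiset.prod_replicate, SymFun.p_one, SymFun.pProd]
  rw [Finset.filter_congr fun σ _ => hfix σ,
    Finset.sum_subtype (p := fun σ : Equiv.Perm α => ∀ i, ¬ i ∉ D → σ i = i) _
      fun σ => Finset.mem_filter_univ σ,
    ← (Equiv.Perm.subtypeEquivSubtypePerm (· ∉ D)).sum_comp]
  simp only [Equiv.Perm.subtypeEquivSubtypePerm_apply_coe, hpProd]
  rw [← Finset.sum_mul, sum_pProd_partition, hcard, smul_mul_assoc]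

theorem sum_choose_smul_pProd_partition (d : ℕ) :
    ∑ σ : Equiv.Perm α, (#σ.supportᶜ).choose d • SymFun.pProd σ.partition.parts =
      ((Fintype.card α).choose d * (Fintype.card α - d).factorial) •
        (SymFun.h (Fintype.card α - d) * SymFun.h 1 ^ d) := by
  have hchoose (σ : Equiv.Perm α) :
      (#σ.supportᶜ).choose d • SymFun.pProd σ.partition.parts =
        ∑ D ∈ Finset.powersetCard d Finset.univ,
          if D ⊆ σ.supportᶜ then SymFun.pProd σ.partition.parts else 0 := by
    have hpowerset : {D ∈ Finset.powersetCard d (Finset.univ : Finset α) | D ⊆ σ.supportᶜ} =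
        σ.supportᶜ.powersetCard d := by
      ext D
      simp only [Finset.mem_filter, Finset.mem_powersetCard, Finset.subset_univ, true_and,
        and_comm]
    rw [← Finset.sum_filter, hpowerset, Finset.sum_const, Finset.card_powersetCard]
  simp only [hchoose]
  rw [Finset.sum_comm]
  simp only [← Finset.sum_filter, sum_pProd_partition_of_subset_compl_support]
  refine (Finset.sum_eq_card_nsmul fun D hD => by rw [(Finset.mem_powersetCard.1 hD).2]).trans ?_
  rw [Finset.card_powersetCard, Finset.card_univ, smul_smul]

theorem sum_descFactorial_smul_pProd_partition {d : ℕ} (hd : d ≤ Fintype.card α) :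
    ∑ σ : Equiv.Perm α, (#σ.supportᶜ).descFactorial d • SymFun.pProd σ.partition.parts =
      (Fintype.card α).factorial • (SymFun.h (Fintype.card α - d) * SymFun.h 1 ^ d) := by
  simp only [Nat.descFactorial_eq_factorial_mul_choose, mul_smul]
  rw [← Finset.smul_sum, sum_choose_smul_pProd_partition, smul_smul,
    ← Nat.choose_mul_factorial_mul_factorial hd]
  congr 1
  ring

end CycleIndex

section Stirling

open PowerSeries

/-- The generating function `∑ r, S(r, d) X ^ r` of the Stirling numbers of the second kind. -/
noncomputable def stirlingSecondSeries (R : Type*) [Semiring R] (d : ℕ) : R⟦X⟧ :=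
  mk fun r => (r.stirlingSecond d : R)

variable {R : Type*}

theorem stirlingSecondSeries_zero [Semiring R] : stirlingSecondSeries R 0 = 1 := by
  ext (_ | r) <;> simp [stirlingSecondSeries, coeff_one]

theorem one_sub_mul_stirlingSecondSeries_succ [CommRing R] (d : ℕ) :
    (1 - C ((d + 1 : ℕ) : R) * X) * stirlingSecondSeries R (d + 1) =
      X * stirlingSecondSeries R d := by
  rw [sub_mul, one_mul, sub_eq_iff_eq_add, mul_assoc, mul_left_comm, ← mul_add]
  ext (_ | r)
  · simp [stirlingSecondSeries]
  · rw [coeff_succ_X_mul, map_add, coeff_C_mul]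
    simp only [stirlingSecondSeries, coeff_mk, Nat.stirlingSecond_succ_succ]
    rw [Nat.cast_add, Nat.cast_mul, add_comm]

theorem curlyPochhammer_mul_stirlingSecondSeries (d : ℕ) :
    curlyPochhammer d * stirlingSecondSeries ℚ d = X ^ d := by
  induction d with
  | zero => simp [curlyPochhammer, stirlingSecondSeries_zero]
  | succ d ih =>
    have hsucc : curlyPochhammer (d + 1) =
        curlyPochhammer d * (1 - C ((d + 1 : ℕ) : ℚ) * X) :=
      Finset.prod_Icc_succ_top d.succ_pos _
    rw [hsucc, mul_assoc, one_sub_mul_stirlingSecondSeries_succ, mul_left_comm, ih, pow_succ']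

theorem X_pow_mul_inv_curlyPochhammer (d : ℕ) :
    X ^ d * (curlyPochhammer d)⁻¹ = stirlingSecondSeries ℚ d := by
  have hunit : constantCoeff (curlyPochhammer d) ≠ 0 := by
    simp [curlyPochhammer, map_prod]
  rw [eq_comm, eq_mul_inv_iff_mul_eq hunit, mul_comm, curlyPochhammer_mul_stirlingSecondSeries]

theorem mul_descFactorial_eq_add (x d : ℕ) :
    x * x.descFactorial d = x.descFactorial (d + 1) + d * x.descFactorial d := by
  rw [Nat.descFactorial_succ, ← add_mul]
  rcases le_or_gt d x with h | h
  · rw [Nat.sub_add_cancel h]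
  · rw [Nat.descFactorial_of_lt h, mul_zero, mul_zero]

theorem pow_eq_sum_stirlingSecond_mul_descFactorial {n x : ℕ} (hx : x ≤ n) (r : ℕ) :
    x ^ r = ∑ d ∈ Finset.range (n + 1), r.stirlingSecond d * x.descFactorial d := by
  induction r with
  | zero => simp [Finset.sum_range_succ']
  | succ r ih =>
    have htop : x.descFactorial (n + 1) = 0 := Nat.descFactorial_of_lt (Nat.lt_succ_of_le hx)
    calc x ^ (r + 1)
        = ∑ d ∈ Finset.range (n + 1), r.stirlingSecond d * x.descFactorial (d + 1) +
            ∑ d ∈ Finset.range (n + 1), r.stirlingSecond d * (d * x.descFactorial d) := by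
          simp only [pow_succ', ih, Finset.mul_sum, ← Finset.sum_add_distrib, ← mul_add,
            ← mul_descFactorial_eq_add, mul_left_comm x]
      _ = ∑ d ∈ Finset.range n, (r.stirlingSecond d * x.descFactorial (d + 1) +
            r.stirlingSecond (d + 1) * ((d + 1 : ℕ) * x.descFactorial (d + 1))) := by
          rw [Finset.sum_range_succ, htop, mul_zero, add_zero, Finset.sum_range_succ' _ n,
            zero_mul, mul_zero, add_zero, Finset.sum_add_distrib]
      _ = ∑ d ∈ Finset.range (n + 1), (r + 1).stirlingSecond d * x.descFactorial d := by
          rw [Finset.sum_range_succ', Nat.stirlingSecond_succ_zero, zero_mul, add_zero]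
          refine Finset.sum_congr rfl fun d _ => ?_
          rw [Nat.stirlingSecond_succ_succ]
          ring

end Stirling

section Character

open scoped Finset

theorem trace_eq_card_fixed_of_apply_basis {R M ι : Type*} [CommRing R] [AddCommGroup M]
    [Module R M] [Fintype ι] [DecidableEq ι] (b : Module.Basis ι R M) {f : M →ₗ[R] M} {s : ι → ι}
    (hf : ∀ i, f (b i) = b (s i)) :
    LinearMap.trace R M f = #{i | s i = i} := by
  rw [LinearMap.trace_eq_matrix_trace R b, Matrix.trace, Finset.card_filter, Nat.cast_sum]
  refine Finset.sum_congr rfl fun i _ => ?_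
  rw [Matrix.diag_apply, LinearMap.toMatrix_apply, hf, Module.Basis.repr_self,
    Finsupp.single_apply, Nat.cast_ite, Nat.cast_one, Nat.cast_zero]

theorem linearIndependent_ncMonomial (n : ℕ) :
    LinearIndependent ℚ (ncMonomial : List (Fin n) → FreeAlgebra ℚ (Fin n)) := by
  have hbasis : (ncMonomial : List (Fin n) → _) =
      FreeAlgebra.basisFreeMonoid ℚ (Fin n) ∘ FreeMonoid.ofList :=
    funext fun w => ncMonomial_eq_basis (FreeMonoid.ofList w)
  rw [hbasis]
  exact (FreeAlgebra.basisFreeMonoid ℚ (Fin n)).linearIndependent.comp _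
    FreeMonoid.ofList.injective

theorem span_range_ncMonomial_ofFn (n r : ℕ) :
    Submodule.span ℚ (Set.range fun w : Fin r → Fin n => ncMonomial (List.ofFn w)) =
      (ncHomogeneous n r).toSubmodule := by
  have hwords : {w : List (Fin n) | w.length = r} = Set.range (List.ofFn (n := r)) := by
    ext w
    exact ⟨fun hw => hw ▸ ⟨w.get, List.ofFn_get w⟩, fun ⟨_, hv⟩ => hv ▸ List.length_ofFn⟩
  change _ = Submodule.span ℚ (ncMonomial '' {w : List (Fin n) | w.length = r})
  rw [hwords, ← Set.range_comp]
  rfl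

/-- The basis of the homogeneous component of degree `r` consisting of the monomials
`x_{w_1} x_{w_2} ⋯ x_{w_r}`, indexed by the words `w`. -/
noncomputable def ncHomogeneousBasis (n r : ℕ) :
    Module.Basis (Fin r → Fin n) ℚ (ncHomogeneous n r).toSubmodule :=
  (Module.Basis.span ((linearIndependent_ncMonomial n).comp _ List.ofFn_injective)).map
    (LinearEquiv.ofEq _ _ (span_range_ncMonomial_ofFn n r))

theorem coe_ncHomogeneousBasis {n r : ℕ} (w : Fin r → Fin n) :
    (ncHomogeneousBasis n r w : FreeAlgebra ℚ (Fin n)) = ncMonomial (List.ofFn w) := by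
  simp [ncHomogeneousBasis, Module.Basis.span_apply]

theorem toRepresentation_ncHomogeneousBasis {n r : ℕ} (σ : Equiv.Perm (Fin n))
    (w : Fin r → Fin n) :
    (ncHomogeneous n r).toRepresentation σ (ncHomogeneousBasis n r w) =
      ncHomogeneousBasis n r (σ ∘ w) := by
  refine Subtype.ext ?_
  change variableAction n σ (ncHomogeneousBasis n r w) = _
  rw [coe_ncHomogeneousBasis, coe_ncHomogeneousBasis, variableAction_ncMonomial, List.map_ofFn]

theorem card_filter_perm_comp_eq_self {ι α : Type*} [Fintype ι] [DecidableEq ι] [Fintype α]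
    [DecidableEq α] (σ : Equiv.Perm α) :
    #{w : ι → α | σ ∘ w = w} = #σ.supportᶜ ^ Fintype.card ι := by
  have hpi : ({w : ι → α | σ ∘ w = w} : Finset (ι → α)) =
      Fintype.piFinset fun _ => σ.supportᶜ := by
    ext w
    simp only [Finset.mem_filter_univ, Fintype.mem_piFinset, Finset.mem_compl,
      Equiv.Perm.notMem_support, funext_iff, Function.comp_apply]
  rw [hpi, Fintype.card_piFinset, Finset.prod_const, Finset.card_univ]

theorem character_ncHomogeneous (n r : ℕ) (σ : Equiv.Perm (Fin n)) :
    (ncHomogeneous n r).toRepresentation.character σ = (#σ.supportᶜ ^ r : ℕ) := by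
  rw [Representation.character, trace_eq_card_fixed_of_apply_basis (ncHomogeneousBasis n r)
    (toRepresentation_ncHomogeneousBasis σ), card_filter_perm_comp_eq_self, Fintype.card_fin]

theorem frob_ncHomogeneous (n r : ℕ) :
    frob (ncHomogeneous n r).toRepresentation =
      ∑ d ∈ Finset.range (n + 1), r.stirlingSecond d • (SymFun.h (n - d) * SymFun.h 1 ^ d) := by
  have hfixed (σ : Equiv.Perm (Fin n)) : #σ.supportᶜ ≤ n := card_finset_fin_le _
  rw [frob, inv_smul_eq_iff₀ (Nat.cast_ne_zero.2 n.factorial_ne_zero)]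
  simp only [character_ncHomogeneous, Nat.cast_smul_eq_nsmul,
    pow_eq_sum_stirlingSecond_mul_descFactorial (hfixed _) r, Finset.sum_smul, mul_smul]
  rw [Finset.sum_comm, Finset.smul_sum]
  refine Finset.sum_congr rfl fun d hd => ?_
  have hdn : d ≤ Fintype.card (Fin n) := by
    rw [Fintype.card_fin]
    exact Finset.mem_range_succ_iff.1 hd
  rw [← Finset.smul_sum, sum_descFactorial_smul_pProd_partition hdn, Fintype.card_fin, smul_comm]

end Character

theorem SymFun.hProd_cons_replicate_one (k d : ℕ) :
    SymFun.hProd (k ::ₘ Multiset.replicate d 1) = SymFun.h k * SymFun.h 1 ^ d := by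
  rw [SymFun.hProd, Multiset.map_cons, Multiset.prod_cons, Multiset.map_replicate,
    Multiset.prod_replicate]

theorem mainTheorem7 (n : ℕ) :
    gradedFrob (ncHomogeneous n) (ncHomogeneous_isInternal n) (ncHomogeneous_finite n) =
      ∑ d ∈ Finset.range (n + 1),
        PowerSeries.map (algebraMap ℚ SymFun) (PowerSeries.X ^ d * (curlyPochhammer d)⁻¹) *
          PowerSeries.C (SymFun.hProd ((n - d) ::ₘ Multiset.replicate d 1)) := by
  ext1 r
  rw [gradedFrob, PowerSeries.coeff_mk, frob_ncHomogeneous, map_sum]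
  refine Finset.sum_congr rfl fun d _ => ?_
  rw [X_pow_mul_inv_curlyPochhammer, SymFun.hProd_cons_replicate_one, PowerSeries.coeff_mul_C,
    PowerSeries.coeff_map, stirlingSecondSeries, PowerSeries.coeff_mk, map_natCast, nsmul_eq_mul]
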